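/- Let $X$ be a compact connected complex manifold of dimension $n$ and let $L\to X$ be a holomorphic line bundle that admits a smooth hermitian metric of positive curvature (so that $(X,L)$ is a polarized Kähler manifold). Let $\mathcal H$ be the space of smooth hermitian metrics $h$ on $L$ with positive curvature, and let $\mathcal B$ be the space of hermitian inner products on $H^0(X,L)$. For $h\in\mathcal H$ put $\omega=\frac i2\Theta_h$, where locally $\Theta_h=-\partial\bar\partial\log|e|_h^2$ for a holomorphic frame $e$ of $L$, and $$\langle s,t\rangle_{\mathrm{Hilb}(h)}=\int_X (s,t)_h\,\frac{\omega^n}{n!},\qquad s,t\in H^0(X,L).$$ A set $S$ of sections generates $L$ if for every $p\in X$ some $s\in S$ satisfies $s(p)\ne 0$. Then: (1) $\mathrm{Hilb}$ maps $\mathcal H$ into $\mathcal B$. (2) Let $\{s_1,\dots,s_m\}$ be a basis of $H^0(X,L)$ such that $\{s_1,\dots,s_{m-1}\}$ generates $L$, and write $(\mathrm{Hilb}(h))_{ij}=\langle s_i,s_j\rangle_{\mathrm{Hilb}(h)}$. Then the maximum $$M=\max_{p\in X}\frac{|s_m(p)|_h^2}{\sum_{i=1}^{m-1}|s_i(p)|_h^2}$$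 exists, is finite, and is the same for all smooth hermitian metrics $h$ on $L$; and for every $h\in\mathcal H$, $$(\mathrm{Hilb}(h))_{mm}<M\sum_{i=1}^{m-1}(\mathrm{Hilb}(h))_{ii}.$$ (3) If $H^0(X,L)$ is more than generating $L$, that is, if some proper linear subspace of $H^0(X,L)$ already generates $L$, then $\mathrm{Hilb}:\mathcal H\to\mathcal B$ is not surjective. -/

import Mathlib

open Bundle Set MeasureTheory
open scoped Manifold ContDiff ComplexConjugate ComplexOrder

noncomputable section

namespace HilbertMap

/-! ## Wirtinger derivatives on `ℂⁿ` -/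

/-- `∂F/∂z_j = (∂F/∂x_j - i ∂F/∂y_j) / 2`, where `z_j = x_j + i y_j`. -/
def wirtinger {n : ℕ} (j : Fin n) (F : (Fin n → ℂ) → ℂ) (z : Fin n → ℂ) : ℂ :=
  (fderiv ℝ F z (Pi.single j 1) - Complex.I * fderiv ℝ F z (Pi.single j Complex.I)) / 2

/-- `∂F/∂z̄_j = (∂F/∂x_j + i ∂F/∂y_j) / 2`, where `z_j = x_j + i y_j`. -/
def wirtingerBar {n : ℕ} (j : Fin n) (F : (Fin n → ℂ) → ℂ) (z : Fin n → ℂ) : ℂ :=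
  (fderiv ℝ F z (Pi.single j 1) + Complex.I * fderiv ℝ F z (Pi.single j Complex.I)) / 2

/-! ## Hermitian inner products on a complex vector space -/

/-- `B` is a hermitian inner product: linear in the first variable, conjugate symmetric and
positive definite. -/
structure IsHermitianInnerProduct {V : Type*} [AddCommGroup V] [Module ℂ V]
    (B : V → V → ℂ) : Prop where
  add_left : ∀ u v w, B (u + v) w = B u w + B v w
  smul_left : ∀ (c : ℂ) (u w), B (c • u) w = c * B u w
  conj_symm : ∀ u w, conj (B u w) = B w u
  pos : ∀ u, u ≠ 0 → 0 < (B u u).re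

/-- The space of all hermitian inner products on `V`. -/
def hermitianInnerProducts (V : Type*) [AddCommGroup V] [Module ℂ V] : Set (V → V → ℂ) :=
  {B | IsHermitianInnerProduct B}

/-! ## Holomorphic line bundles over complex manifolds

`X` is a complex manifold modelled on `ℂⁿ = (Fin n → ℂ)`, and `L` is a vector bundle over it with
model fibre `ℂ`. Each point `x` has the coordinate neighbourhood `trivDomain n L x`, on which
the preferred chart and the preferred trivialization at `x` are both defined. -/

section

variable (n : ℕ) {X : Type*} [TopologicalSpace X] [ChartedSpace (Fin n → ℂ) X]
  (L : X → Type*) [TopologicalSpace (TotalSpace ℂ L)]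
  [∀ x, TopologicalSpace (L x)] [∀ x, AddCommGroup (L x)] [∀ x, Module ℂ (L x)]
  [FiberBundle ℂ L]

/-- The space `H⁰(X, L)` of holomorphic (that is, complex analytic) global sections of `L`. -/
abbrev HolomorphicSection : Type _ := ContMDiffSection 𝓘(ℂ, Fin n → ℂ) ℂ ω L

/-- A set of sections generates `L` if at each point one of its members does not vanish. -/
def Generates {n : ℕ} {X : Type*} [TopologicalSpace X] [ChartedSpace (Fin n → ℂ) X]
    {L : X → Type*} [TopologicalSpace (TotalSpace ℂ L)]
    [∀ x, TopologicalSpace (L x)] [∀ x, AddCommGroup (L x)] [∀ x, Module ℂ (L x)]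
    [FiberBundle ℂ L] (S : Set (HolomorphicSection n L)) : Prop :=
  ∀ p : X, ∃ s ∈ S, s p ≠ 0

/-- A coordinate neighbourhood of `x` over which `L` is trivialized. -/
def trivDomain (x : X) : Set X :=
  (chartAt (Fin n → ℂ) x).source ∩ (trivializationAt ℂ L x).baseSet

/-- The image of `trivDomain n L x` in `ℂⁿ` under the chart at `x`. -/
def coordDomain (x : X) : Set (Fin n → ℂ) :=
  (chartAt (Fin n → ℂ) x).target ∩
    (chartAt (Fin n → ℂ) x).symm ⁻¹' (trivializationAt ℂ L x).baseSet

variable {L} in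
/-- For a family `B` of forms on the fibres of `L`: the function `|e|² = B(e, e)` on the coordinate
neighbourhood of `x`, written in the coordinates, where `e` is the local holomorphic frame of `L`
given by the trivialization at `x`. -/
def localNormSq (B : ∀ p, L p → L p → ℂ) (x : X) (z : Fin n → ℂ) : ℝ :=
  let p := (chartAt (Fin n → ℂ) x).symm z
  (B p ((trivializationAt ℂ L x).symm p 1) ((trivializationAt ℂ L x).symm p 1)).re

/-- A smooth hermitian metric on the line bundle `L`. -/
structure HermitianMetric where
  /-- the pairing `(v, w)_h` on the fibre of `L` at `p` -/
  form : ∀ p, L p → L p → ℂ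
  isInner : ∀ p, IsHermitianInnerProduct (form p)
  smooth : ∀ x : X, ContDiffOn ℝ ∞ (localNormSq n form x) (coordDomain n L x)

variable {n L}

/-- `|v|²_h`. -/
def HermitianMetric.normSq (h : HermitianMetric n L) (p : X) (v : L p) : ℝ := (h.form p v v).re

/-- The curvature form `Θ_h = -∂∂̄ log |e|²_h` is `∑ g_{jk} dz_j ∧ dz̄_k` in the coordinates of the
chart at `x`, with `g_{jk} = -∂²(log |e|²_h) / ∂z_j ∂z̄_k`. This is the matrix `g`. The real form
`ω = (i/2) Θ_h` is then `(i/2) ∑ g_{jk} dz_j ∧ dz̄_k`. -/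
def HermitianMetric.curvature (h : HermitianMetric n L) (x : X) (z : Fin n → ℂ) :
    Matrix (Fin n) (Fin n) ℂ :=
  Matrix.of fun j k =>
    -wirtinger j (wirtingerBar k fun w => ((Real.log (localNormSq n h.form x w) : ℝ) : ℂ)) z

variable (n L)

/-- The space `ℋ` of smooth hermitian metrics on `L` with positive curvature. -/
structure PositiveMetric extends HermitianMetric n L where
  curvature_pos : ∀ x : X, ∀ z ∈ coordDomain n L x, (toHermitianMetric.curvature x z).PosDef

variable {n L}

/-! ## The volume form `ωⁿ/n!` and the Hilbert map -/

variable [CompactSpace X] [T2Space X]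

variable (n L) in
theorem exists_partition :
    ∃ ρ : PartitionOfUnity X X univ, ρ.IsSubordinate (trivDomain n L) := by
  refine PartitionOfUnity.exists_isSubordinate isClosed_univ _ (fun x => ?_) (fun x _ => ?_)
  · exact (chartAt (Fin n → ℂ) x).open_source.inter (trivializationAt ℂ L x).open_baseSet
  · exact mem_iUnion.2 ⟨x, mem_chart_source _ x, mem_baseSet_trivializationAt ℂ L x⟩

variable (n L) in
/-- A partition of unity subordinate to the cover of `X` by the coordinate neighbourhoods
`trivDomain n L x`, `x ∈ X`. -/
def partition : PartitionOfUnity X X univ := (exists_partition n L).choose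

variable [MeasurableSpace X]

/-- The measure on `X` given by the volume form `ωⁿ/n!`, where `ω = (i/2) Θ_h`. In coordinates,
`ωⁿ/n! = det (g_{jk}) ∏ (i/2) dz_j ∧ dz̄_j = det (g_{jk}) dx₁ dy₁ ⋯ dx_n dy_n`; as usual, these local
expressions are put together by a partition of unity. -/
def PositiveMetric.volume (h : PositiveMetric n L) : Measure X :=
  Measure.sum fun x : X =>
    Measure.map (chartAt (Fin n → ℂ) x).symm
      ((MeasureTheory.volume.restrict (coordDomain n L x)).withDensity fun z =>
        ENNReal.ofReal (partition n L x ((chartAt (Fin n → ℂ) x).symm z) *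
          (h.curvature x z).det.re))

/-- The Hilbert map: `⟨s, t⟩_{Hilb(h)} = ∫_X (s, t)_h ωⁿ/n!`. -/
def hilb (h : PositiveMetric n L) (s t : HolomorphicSection n L) : ℂ :=
  ∫ p, h.form p (s p) (t p) ∂h.volume

end

end HilbertMap

end

namespace HilbertMap

set_option linter.unusedSectionVars false

/-! ## Hermitian inner products -/

namespace IsHermitianInnerProduct

variable {V : Type*} [AddCommGroup V] [Module ℂ V] {B : V → V → ℂ}

/-! In a local frame `e`, both norms in the quotient $|s_m|_h^2/\sum_{i<m}|s_i|_h^2$ carry the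
factor $|e|_h^2$, which cancels (`normSq_div_sum_eq`). The quotient is therefore a continuous
function independent of $h$, and compactness gives its maximum $M$. Integrating $|s_m|_h^2\le
M\sum_{i<m}|s_i|_h^2$ against $\omega^n/n!$ gives the weak form of (2).

For strictness, $s_m$ must vanish somewhere: otherwise each $s_i/s_m$ would be a holomorphic
function on a compact connected manifold, hence constant, against linear independence
(`exists_eq_smul_of_forall_ne_zero`). At a zero of $s_m$ the integrand is positive, and the volume
measure charges every nonempty open set (`isOpenPosMeasure_volume`). The same fact gives
definiteness in (1).

For (3), finitely many sections of the proper subspace $V$ already generate, so every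
$\mathrm{Hilb}(g)$ bounds $\|u\|^2$, $u\notin V$, by a fixed multiple of the sum of their squared
norms. Adding a large multiple of $|f|^2$ to some $\mathrm{Hilb}(h)$, where $f$ is a linear form
with $f|_V=0$ and $f(u)\ne0$, breaks this bound (`add_mul_conj`). -/

theorem smul_right (hB : IsHermitianInnerProduct B) (c : ℂ) (u w : V) :
    B u (c • w) = conj c * B u w := by
  rw [← hB.conj_symm, hB.smul_left, map_mul, hB.conj_symm]

theorem smul_smul (hB : IsHermitianInnerProduct B) (c d : ℂ) (u w : V) :
    B (c • u) (d • w) = c * conj d * B u w := by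
  rw [hB.smul_left, hB.smul_right, mul_assoc]

theorem self_eq_ofReal_re (hB : IsHermitianInnerProduct B) (u : V) :
    B u u = ((B u u).re : ℂ) :=
  (Complex.conj_eq_iff_re.1 (hB.conj_symm u u)).symm

theorem re_smul_self (hB : IsHermitianInnerProduct B) (c : ℂ) (u : V) :
    (B (c • u) (c • u)).re = Complex.normSq c * (B u u).re := by
  rw [hB.smul_smul, Complex.mul_conj, Complex.re_ofReal_mul]

theorem zero_left (hB : IsHermitianInnerProduct B) (w : V) : B 0 w = 0 := by
  simpa using hB.smul_left 0 0 w

theorem re_self_nonneg (hB : IsHermitianInnerProduct B) (u : V) : 0 ≤ (B u u).re := by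
  rcases eq_or_ne u 0 with rfl | hu
  · rw [hB.zero_left, Complex.zero_re]
  · exact (hB.pos u hu).le

theorem re_self_pos_iff (hB : IsHermitianInnerProduct B) {u : V} : 0 < (B u u).re ↔ u ≠ 0 := by
  refine ⟨?_, hB.pos u⟩
  rintro h rfl
  rw [hB.zero_left, Complex.zero_re] at h
  exact h.false

/-- Adding a nonnegative multiple of the square of a linear form to a hermitian inner product. -/
theorem add_mul_conj (hB : IsHermitianInnerProduct B) (f : V →ₗ[ℂ] ℂ) {c : ℝ} (hc : 0 ≤ c) :
    IsHermitianInnerProduct fun u w => B u w + c * (f u * conj (f w)) where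
  add_left u v w := by rw [hB.add_left, map_add]; ring
  smul_left a u w := by rw [hB.smul_left, map_smul, smul_eq_mul]; ring
  conj_symm u w := by
    simp only [map_add, map_mul, Complex.conj_conj, Complex.conj_ofReal, hB.conj_symm]; ring
  pos u hu := by
    rw [Complex.mul_conj, Complex.add_re, ← Complex.ofReal_mul, Complex.ofReal_re]
    exact add_pos_of_pos_of_nonneg (hB.pos u hu) (mul_nonneg hc (Complex.normSq_nonneg _))

end IsHermitianInnerProduct

section

variable {n : ℕ} {X : Type*} [TopologicalSpace X] [ChartedSpace (Fin n → ℂ) X]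
  {L : X → Type*} [TopologicalSpace (TotalSpace ℂ L)]
  [∀ x, TopologicalSpace (L x)] [∀ x, AddCommGroup (L x)] [∀ x, Module ℂ (L x)]
  [FiberBundle ℂ L]

/-! ## Coordinate neighbourhoods and local frames -/

variable (n L) in
theorem isOpen_trivDomain (x : X) : IsOpen (trivDomain n L x) :=
  (chartAt (Fin n → ℂ) x).open_source.inter (trivializationAt ℂ L x).open_baseSet

variable (n L) in
theorem mem_trivDomain (x : X) : x ∈ trivDomain n L x :=
  ⟨mem_chart_source _ x, mem_baseSet_trivializationAt ℂ L x⟩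

variable (n L) in
theorem isOpen_coordDomain (x : X) : IsOpen (coordDomain n L x) :=
  (chartAt (Fin n → ℂ) x).isOpen_inter_preimage_symm (trivializationAt ℂ L x).open_baseSet

theorem chartAt_mem_coordDomain {x p : X} (hp : p ∈ trivDomain n L x) :
    chartAt (Fin n → ℂ) x p ∈ coordDomain n L x := by
  refine ⟨(chartAt (Fin n → ℂ) x).map_source hp.1, ?_⟩
  rw [mem_preimage, (chartAt (Fin n → ℂ) x).left_inv hp.1]
  exact hp.2

/-- The local frame of `L` given by the trivialization at `x`. -/
noncomputable def frame (L : X → Type*) [TopologicalSpace (TotalSpace ℂ L)]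
    [∀ x, TopologicalSpace (L x)] [∀ x, AddCommGroup (L x)] [∀ x, Module ℂ (L x)]
    [FiberBundle ℂ L] (x p : X) : L p :=
  (trivializationAt ℂ L x).symm p 1

/-- The coefficient of a section with respect to the local frame at `x`. -/
noncomputable def coeff (s : HolomorphicSection n L) (x p : X) : ℂ :=
  (trivializationAt ℂ L x ⟨p, s p⟩).2

theorem localNormSq_chartAt (B : ∀ p, L p → L p → ℂ) {x p : X} (hp : p ∈ trivDomain n L x) :
    localNormSq n B x (chartAt (Fin n → ℂ) x p) = (B p (frame L x p) (frame L x p)).re := by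
  have key : ∀ q, q = p → (B q (frame L x q) (frame L x q)).re =
      (B p (frame L x p) (frame L x p)).re := by
    rintro _ rfl
    rfl
  exact key _ ((chartAt (Fin n → ℂ) x).left_inv hp.1)

theorem HermitianMetric.localNormSq_pos [VectorBundle ℂ ℂ L] (h : HermitianMetric n L) {x : X}
    {z : Fin n → ℂ} (hz : z ∈ coordDomain n L x) : 0 < localNormSq n h.form x z := by
  refine (h.isInner _).pos _ fun h0 => ?_
  have hb := hz.2
  rw [mem_preimage] at hb
  have := (trivializationAt ℂ L x).apply_mk_symm hb (1 : ℂ)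
  rw [h0] at this
  have h2 := ((trivializationAt ℂ L x).linear ℂ hb).map_zero
  rw [this] at h2
  exact one_ne_zero h2

theorem eq_coord_smul_frame [VectorBundle ℂ ℂ L] {x p : X}
    (hp : p ∈ (trivializationAt ℂ L x).baseSet) (v : L p) :
    v = (trivializationAt ℂ L x ⟨p, v⟩).2 • frame L x p := by
  conv_lhs => rw [← (trivializationAt ℂ L x).symm_apply_apply_mk hp v]
  rw [frame, ← (trivializationAt ℂ L x).symmₗ_apply (R := ℂ) hp,
    ← (trivializationAt ℂ L x).symmₗ_apply (R := ℂ) hp, ← map_smul, smul_eq_mul, mul_one]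

theorem HolomorphicSection.apply_eq_coeff_smul_frame [VectorBundle ℂ ℂ L]
    (s : HolomorphicSection n L) {x p : X} (hp : p ∈ trivDomain n L x) :
    s p = coeff s x p • frame L x p :=
  eq_coord_smul_frame hp.2 (s p)

theorem continuousOn_coeff (s : HolomorphicSection n L) (x : X) :
    ContinuousOn (coeff s x) (trivDomain n L x) := by
  have hs : Continuous fun p => (⟨p, s p⟩ : TotalSpace ℂ L) := s.contMDiff.continuous
  refine continuous_snd.comp_continuousOn
    ((trivializationAt ℂ L x).continuousOn.comp hs.continuousOn fun p hp => ?_)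
  exact (trivializationAt ℂ L x).mem_source.2 hp.2

theorem mdifferentiableAt_coeff (s : HolomorphicSection n L) (x : X) :
    MDifferentiableAt 𝓘(ℂ, Fin n → ℂ) 𝓘(ℂ, ℂ) (coeff s x) x :=
  ((contMDiffAt_section x).1 (s.contMDiff x)).mdifferentiableAt (by simp)

namespace HermitianMetric

variable [VectorBundle ℂ ℂ L] (h : HermitianMetric n L)

/-! ## Continuity of the pairing of two sections -/

/-- Smoothness of a metric is only assumed for $|e|_h^2$. As the fibres are lines, this formula
carries it over to the pairing of arbitrary sections. -/
theorem form_apply_eq (s t : HolomorphicSection n L) {x p : X} (hp : p ∈ trivDomain n L x) :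
    h.form p (s p) (t p) = coeff s x p * conj (coeff t x p) *
      (localNormSq n h.form x (chartAt (Fin n → ℂ) x p) : ℂ) := by
  rw [localNormSq_chartAt _ hp, ← (h.isInner p).self_eq_ofReal_re, ← (h.isInner p).smul_smul,
    ← s.apply_eq_coeff_smul_frame hp, ← t.apply_eq_coeff_smul_frame hp]

theorem continuousOn_form (s t : HolomorphicSection n L) (x : X) :
    ContinuousOn (fun p => h.form p (s p) (t p)) (trivDomain n L x) := by
  have hφ : ContinuousOn (fun p => localNormSq n h.form x (chartAt (Fin n → ℂ) x p))
      (trivDomain n L x) :=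
    (h.smooth x).continuousOn.comp
      ((chartAt (Fin n → ℂ) x).continuousOn.mono inter_subset_left)
      fun p hp => chartAt_mem_coordDomain hp
  refine ContinuousOn.congr ?_ fun p hp => h.form_apply_eq s t hp
  exact ((continuousOn_coeff s x).mul
    (Complex.continuous_conj.comp_continuousOn (continuousOn_coeff t x))).mul
    (Complex.continuous_ofReal.comp_continuousOn hφ)

theorem continuous_form (s t : HolomorphicSection n L) :
    Continuous fun p => h.form p (s p) (t p) :=
  continuous_iff_continuousAt.2 fun x =>
    (h.continuousOn_form s t x).continuousAt ((isOpen_trivDomain n L x).mem_nhds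
      (mem_trivDomain n L x))

theorem continuous_normSq (s : HolomorphicSection n L) : Continuous fun p => h.normSq p (s p) :=
  Complex.continuous_re.comp (h.continuous_form s s)

theorem normSq_nonneg (p : X) (v : L p) : 0 ≤ h.normSq p v := (h.isInner p).re_self_nonneg v

theorem normSq_pos_iff {p : X} {v : L p} : 0 < h.normSq p v ↔ v ≠ 0 :=
  (h.isInner p).re_self_pos_iff

theorem isOpen_setOf_apply_ne_zero (h : HermitianMetric n L) (s : HolomorphicSection n L) :
    IsOpen {p | s p ≠ 0} := by
  simp only [← h.normSq_pos_iff]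
  exact isOpen_lt continuous_const (h.continuous_normSq s)

/-! ## The quotient of the norms of sections -/

theorem sum_normSq_pos {ι : Type*} {t : Finset ι} {s : ι → HolomorphicSection n L} {p : X}
    (hs : ∃ i ∈ t, s i p ≠ 0) : 0 < ∑ i ∈ t, h.normSq p (s i p) := by
  obtain ⟨i, hi, hne⟩ := hs
  exact Finset.sum_pos' (fun j _ => h.normSq_nonneg p _) ⟨i, hi, h.normSq_pos_iff.2 hne⟩

theorem normSq_div_sum_eq (h' : HermitianMetric n L) {ι : Type*} (t : Finset ι)
    (s : ι → HolomorphicSection n L) (u : HolomorphicSection n L) (p : X) :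
    h.normSq p (u p) / ∑ i ∈ t, h.normSq p (s i p) =
      h'.normSq p (u p) / ∑ i ∈ t, h'.normSq p (s i p) := by
  have key (g : HermitianMetric n L) : g.normSq p (u p) / ∑ i ∈ t, g.normSq p (s i p) =
      Complex.normSq (coeff u p p) / ∑ i ∈ t, Complex.normSq (coeff (s i) p p) := by
    have hN (w : HolomorphicSection n L) : g.normSq p (w p) =
        Complex.normSq (coeff w p p) * g.normSq p (frame L p p) := by
      rw [normSq, w.apply_eq_coeff_smul_frame (mem_trivDomain n L p), (g.isInner p).re_smul_self,
        ← normSq]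
    have hne : g.normSq p (frame L p p) ≠ 0 := by
      have := g.localNormSq_pos (chartAt_mem_coordDomain (mem_trivDomain n L p))
      rw [localNormSq_chartAt _ (mem_trivDomain n L p)] at this
      exact this.ne'
    simp only [hN, ← Finset.sum_mul]
    exact mul_div_mul_right _ _ hne
  rw [key h, key h']

/-- One $M$ serves all metrics at once; the argument for (3) depends on this uniformity. -/
theorem exists_isGreatest (h : HermitianMetric n L) [CompactSpace X] [Nonempty X] {ι : Type*} (t : Finset ι)
    (s : ι → HolomorphicSection n L) (hs : ∀ p, ∃ i ∈ t, s i p ≠ 0)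
    (u : HolomorphicSection n L) :
    ∃ M : ℝ, ∀ h' : HermitianMetric n L, IsGreatest
      (range fun p : X => h'.normSq p (u p) / ∑ i ∈ t, h'.normSq p (s i p)) M := by
  have hc : Continuous fun p : X => h.normSq p (u p) / ∑ i ∈ t, h.normSq p (s i p) :=
    (h.continuous_normSq u).div (continuous_finsetSum _ fun i _ => h.continuous_normSq (s i))
      fun p => (h.sum_normSq_pos (hs p)).ne'
  obtain ⟨p, -, hp⟩ := isCompact_univ.exists_isMaxOn univ_nonempty hc.continuousOn
  refine ⟨h.normSq p (u p) / ∑ i ∈ t, h.normSq p (s i p), fun h' => ?_⟩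
  rw [show (fun p : X => h'.normSq p (u p) / ∑ i ∈ t, h'.normSq p (s i p)) =
    fun p => h.normSq p (u p) / ∑ i ∈ t, h.normSq p (s i p) from
      funext fun p => h'.normSq_div_sum_eq h t s u p]
  exact ⟨mem_range_self p, forall_mem_range.2 fun q => hp (mem_univ q)⟩

/-- On a compact connected complex manifold, a section is a constant multiple of any nowhere
vanishing section. -/
theorem exists_eq_smul_of_forall_ne_zero (h : HermitianMetric n L)
    [IsManifold 𝓘(ℂ, Fin n → ℂ) ω X]
    [CompactSpace X] [ConnectedSpace X] (s t : HolomorphicSection n L) (ht : ∀ p, t p ≠ 0) :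
    ∃ c : ℂ, s = c • t := by
  have hne (p : X) : h.form p (t p) (t p) ≠ 0 := fun h0 => by
    have := (h.isInner p).pos _ (ht p)
    rw [h0, Complex.zero_re] at this
    exact this.false
  -- The quotient $s/t$ is written globally as $(s,t)_h/(t,t)_h$. Locally $|e|_h^2$ and the
  -- conjugate coefficient of $t$ cancel, leaving a quotient of holomorphic coefficients.
  have hd : MDifferentiable 𝓘(ℂ, Fin n → ℂ) 𝓘(ℂ, ℂ)
      fun p => h.form p (s p) (t p) / h.form p (t p) (t p) := by
    intro x
    have hx : coeff t x x ≠ 0 := fun h0 => ht x <| by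
      rw [t.apply_eq_coeff_smul_frame (mem_trivDomain n L x), h0, zero_smul]
    have hinv : MDifferentiableAt 𝓘(ℂ, Fin n → ℂ) 𝓘(ℂ, ℂ) (fun p => (coeff t x p)⁻¹) x :=
      (differentiableAt_inv hx).mdifferentiableAt.comp x (mdifferentiableAt_coeff t x)
    refine ((mdifferentiableAt_coeff s x).mul hinv).congr_of_eventuallyEq ?_
    filter_upwards [(isOpen_trivDomain n L x).mem_nhds (mem_trivDomain n L x)] with p hp
    have hp0 := hne p
    rw [h.form_apply_eq s t hp, h.form_apply_eq t t hp]
    rw [h.form_apply_eq t t hp, mul_assoc] at hp0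
    rw [mul_assoc, mul_assoc, mul_div_mul_right _ _ (right_ne_zero_of_mul hp0), div_eq_mul_inv]
    rfl
  obtain ⟨c, hc⟩ := hd.exists_eq_const_of_compactSpace
  refine ⟨c, ContMDiffSection.ext fun p => ?_⟩
  have hcp : h.form p (s p) (t p) / h.form p (t p) (t p) = c := congrFun hc p
  have hp := mem_trivDomain n L p
  have hp0 := hne p
  rw [h.form_apply_eq s t hp, h.form_apply_eq t t hp] at hcp
  rw [h.form_apply_eq t t hp, mul_assoc] at hp0
  rw [mul_assoc, mul_assoc, mul_div_mul_right _ _ (right_ne_zero_of_mul hp0),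
    div_eq_iff (left_ne_zero_of_mul hp0)] at hcp
  rw [ContMDiffSection.coe_smul, Pi.smul_apply, s.apply_eq_coeff_smul_frame hp,
    t.apply_eq_coeff_smul_frame hp, hcp, mul_smul]

/-! ## Continuity of the curvature -/

theorem continuousOn_curvature (x : X) (j k : Fin n) :
    ContinuousOn (fun z => h.curvature x z j k) (coordDomain n L x) := by
  have ho := isOpen_coordDomain n L x
  have hF : ContDiffOn ℝ ∞ (fun w => ((Real.log (localNormSq n h.form x w) : ℝ) : ℂ))
      (coordDomain n L x) :=
    Complex.ofRealCLM.contDiff.comp_contDiffOn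
      ((h.smooth x).log fun z hz => (h.localNormSq_pos hz).ne')
  have hfd := hF.fderiv_of_isOpen ho (m := 1) (by norm_cast)
  have hG : ContDiffOn ℝ 1
      (wirtingerBar k fun w => ((Real.log (localNormSq n h.form x w) : ℝ) : ℂ))
      (coordDomain n L x) := by
    unfold wirtingerBar
    exact ((hfd.clm_apply contDiffOn_const).add
      (contDiffOn_const.mul (hfd.clm_apply contDiffOn_const))).div_const _
  have hfd' := hG.continuousOn_fderiv_of_isOpen ho le_rfl
  simp only [curvature, Matrix.of_apply]
  unfold wirtinger
  exact (((hfd'.clm_apply continuousOn_const).sub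
    (continuousOn_const.mul (hfd'.clm_apply continuousOn_const))).div_const _).neg

theorem continuousOn_det_curvature (x : X) :
    ContinuousOn (fun z => (h.curvature x z).det.re) (coordDomain n L x) := by
  refine Complex.continuous_re.comp_continuousOn ?_
  rw [continuousOn_iff_continuous_domRestrict]
  exact Continuous.matrix_det (continuous_pi fun j => continuous_pi fun k =>
    (h.continuousOn_curvature x j k).domRestrict)

end HermitianMetric

/-! ## The volume measure -/

namespace PositiveMetric

variable [CompactSpace X] [T2Space X] [MeasurableSpace X] [BorelSpace X]
  (h : PositiveMetric n L)

theorem det_curvature_pos {x : X} {z : Fin n → ℂ} (hz : z ∈ coordDomain n L x) :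
    0 < (h.curvature x z).det.re :=
  (Complex.lt_def.1 (h.curvature_pos x z hz).det_pos).1

/-- The density of the volume form in the coordinates at `x`, weighted by the partition of unity. -/
noncomputable def density (x : X) (z : Fin n → ℂ) : ℝ :=
  partition n L x ((chartAt (Fin n → ℂ) x).symm z) * (h.curvature x z).det.re

/-- The part of the volume measure that comes from the coordinate neighbourhood of `x`. -/
noncomputable def localVolume (x : X) : Measure X :=
  Measure.map (chartAt (Fin n → ℂ) x).symm
    ((MeasureTheory.volume.restrict (coordDomain n L x)).withDensity fun z =>
      ENNReal.ofReal (h.density x z))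

theorem volume_eq_sum : h.volume = Measure.sum h.localVolume := rfl

theorem aemeasurable_chartAt_symm (x : X) :
    AEMeasurable (chartAt (Fin n → ℂ) x).symm
      ((MeasureTheory.volume.restrict (coordDomain n L x)).withDensity fun z =>
        ENNReal.ofReal (h.density x z)) :=
  (((chartAt (Fin n → ℂ) x).continuousOn_symm.mono inter_subset_left).aemeasurable
    (isOpen_coordDomain n L x).measurableSet).mono_ac (withDensity_absolutelyContinuous _ _)

variable [VectorBundle ℂ ℂ L]

theorem continuousOn_density (x : X) : ContinuousOn (h.density x) (coordDomain n L x) :=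
  ((partition n L x).continuous.comp_continuousOn
    ((chartAt (Fin n → ℂ) x).continuousOn_symm.mono inter_subset_left)).mul
    (h.continuousOn_det_curvature x)

/-- The coordinate domain may be unbounded, and so may the determinant on it. However, the weighted
density vanishes off the compact image `K` of the support of the partition function, and is bounded
on `K`. -/
theorem localVolume_univ_lt_top (x : X) : h.localVolume x univ < ⊤ := by
  have hsub : tsupport (partition n L x) ⊆ trivDomain n L x := (exists_partition n L).choose_spec x
  set K := chartAt (Fin n → ℂ) x '' tsupport (partition n L x)
  have hK : IsCompact K := (isClosed_tsupport _).isCompact.image_of_continuousOn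
    ((chartAt (Fin n → ℂ) x).continuousOn.mono (hsub.trans inter_subset_left))
  have hKD : K ⊆ coordDomain n L x :=
    image_subset_iff.2 fun p hp => chartAt_mem_coordDomain (hsub hp)
  obtain ⟨C, hC⟩ := hK.bddAbove_image ((h.continuousOn_density x).mono hKD)
  rw [localVolume, Measure.map_apply_of_aemeasurable (h.aemeasurable_chartAt_symm x) .univ,
    preimage_univ, withDensity_apply _ .univ, Measure.restrict_univ]
  calc ∫⁻ z in coordDomain n L x, ENNReal.ofReal (h.density x z)
      ≤ ∫⁻ z in coordDomain n L x, K.indicator (fun _ => ENNReal.ofReal C) z := by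
        refine setLIntegral_mono' (isOpen_coordDomain n L x).measurableSet fun z hz => ?_
        by_cases hzK : z ∈ K
        · rw [indicator_of_mem hzK]
          exact ENNReal.ofReal_le_ofReal (hC (mem_image_of_mem _ hzK))
        · have h0 : partition n L x ((chartAt (Fin n → ℂ) x).symm z) = 0 :=
            image_eq_zero_of_notMem_tsupport fun hmem =>
              hzK ⟨_, hmem, (chartAt (Fin n → ℂ) x).right_inv hz.1⟩
          rw [indicator_of_notMem hzK, density, h0, zero_mul, ENNReal.ofReal_zero]
    _ ≤ ∫⁻ z, K.indicator (fun _ => ENNReal.ofReal C) z := setLIntegral_le_lintegral _ _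
    _ = ENNReal.ofReal C * MeasureTheory.volume K := lintegral_indicator_const hK.measurableSet _
    _ < ⊤ := ENNReal.mul_lt_top ENNReal.ofReal_lt_top hK.measure_lt_top

instance isFiniteMeasure_volume : IsFiniteMeasure h.volume where
  measure_univ_lt_top := by
    -- By compactness, only finitely many members of the locally finite partition are nonzero, so
    -- the sum of measures is finite.
    have hfin := (partition n L).locallyFinite.finite_nonempty_of_compact
    rw [volume_eq_sum, Measure.sum_apply _ .univ, tsum_eq_sum (s := hfin.toFinset)]
    · exact ENNReal.sum_lt_top.2 fun x _ => h.localVolume_univ_lt_top x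
    · intro x hx
      have h0 : ∀ p, partition n L x p = 0 := fun p => by
        by_contra hp
        exact hx (hfin.mem_toFinset.2 ⟨p, hp⟩)
      have hd (z : Fin n → ℂ) : h.density x z = 0 := by rw [density, h0, zero_mul]
      rw [localVolume, Measure.map_apply_of_aemeasurable (h.aemeasurable_chartAt_symm x) .univ]
      simp [hd]

instance isOpenPosMeasure_volume : Measure.IsOpenPosMeasure h.volume where
  open_pos U hU hne := by
    obtain ⟨p, hp⟩ := hne
    obtain ⟨x, hx⟩ : ∃ x, 0 < partition n L x p :=
      (partition n L).exists_pos (mem_univ p)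
    have hsub : tsupport (partition n L x) ⊆ trivDomain n L x :=
      (exists_partition n L).choose_spec x
    have hpx : p ∈ trivDomain n L x := hsub (subset_tsupport _ hx.ne')
    -- On `W` the density is positive: the partition function is, and so is the curvature
    -- determinant. Hence a single chart already gives `U` positive mass.
    set W := U ∩ {q | 0 < partition n L x q}
    have hW : IsOpen W := hU.inter (isOpen_lt continuous_const (partition n L x).continuous)
    set Z := coordDomain n L x ∩ (chartAt (Fin n → ℂ) x).symm ⁻¹' W
    have hZ : IsOpen Z := ((chartAt (Fin n → ℂ) x).continuousOn_symm.mono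
      inter_subset_left).isOpen_inter_preimage (isOpen_coordDomain n L x) hW
    have hZne : Z.Nonempty := by
      refine ⟨chartAt (Fin n → ℂ) x p, chartAt_mem_coordDomain hpx, ?_⟩
      rw [mem_preimage, (chartAt (Fin n → ℂ) x).left_inv hpx.1]
      exact ⟨hp, hx⟩
    have hdpos : ∀ z ∈ Z, 0 < h.density x z := fun z hz =>
      mul_pos hz.2.2 (h.det_curvature_pos hz.1)
    have hmeas : AEMeasurable (fun z => ENNReal.ofReal (h.density x z))
        (MeasureTheory.volume.restrict (coordDomain n L x)) :=
      ((h.continuousOn_density x).aemeasurable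
        (isOpen_coordDomain n L x).measurableSet).ennreal_ofReal
    intro h0
    rw [volume_eq_sum, Measure.sum_apply _ hU.measurableSet, ENNReal.tsum_eq_zero] at h0
    have h1 := h0 x
    rw [localVolume, Measure.map_apply_of_aemeasurable (h.aemeasurable_chartAt_symm x)
      hU.measurableSet] at h1
    have h2 := measure_mono_null (show Z ⊆ _ from fun z hz => hz.2.1) h1
    rw [withDensity_apply_eq_zero' hmeas] at h2
    have h3 : {z | ENNReal.ofReal (h.density x z) ≠ 0} ∩ Z = Z :=
      inter_eq_right.2 fun z hz => (ENNReal.ofReal_pos.2 (hdpos z hz)).ne'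
    rw [h3, Measure.restrict_apply hZ.measurableSet, inter_eq_left.2 inter_subset_left] at h2
    exact (hZ.measure_pos MeasureTheory.volume hZne).ne' h2

end PositiveMetric

/-! ## The Hilbert map -/

variable [CompactSpace X] [T2Space X] [MeasurableSpace X] [BorelSpace X] [VectorBundle ℂ ℂ L]
  (h : PositiveMetric n L)

theorem integrable_of_continuous {E : Type*} [NormedAddCommGroup E]
    [SecondCountableTopology E] {f : X → E} (hf : Continuous f) : Integrable f h.volume :=
  hf.integrable_of_hasCompactSupport (HasCompactSupport.of_compactSpace f)

theorem integrable_form (s t : HolomorphicSection n L) :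
    Integrable (fun p => h.form p (s p) (t p)) h.volume :=
  integrable_of_continuous h (h.continuous_form s t)

theorem re_hilb_self (s : HolomorphicSection n L) :
    (hilb h s s).re = ∫ p, h.normSq p (s p) ∂h.volume :=
  (integral_re (integrable_form h s s)).symm

theorem isHermitianInnerProduct_hilb : IsHermitianInnerProduct (hilb h) where
  add_left s t u := by
    rw [hilb, hilb, hilb, ← integral_add (integrable_form h s u) (integrable_form h t u)]
    exact integral_congr_ae (.of_forall fun p => (h.isInner p).add_left _ _ _)
  smul_left c s u := by
    rw [hilb, hilb, ← integral_const_mul]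
    exact integral_congr_ae (.of_forall fun p => (h.isInner p).smul_left _ _ _)
  conj_symm s t := by
    rw [hilb, hilb, ← integral_conj]
    exact integral_congr_ae (.of_forall fun p => (h.isInner p).conj_symm _ _)
  pos s hs := by
    obtain ⟨p, hp⟩ : ∃ p, s p ≠ 0 := by
      by_contra! h0
      exact hs (ContMDiffSection.ext h0)
    rw [re_hilb_self]
    exact integral_pos_of_integrable_nonneg_nonzero (h.continuous_normSq s)
      (integrable_of_continuous h (h.continuous_normSq s)) (fun q => h.normSq_nonneg q _)
      (h.normSq_pos_iff.2 hp).ne'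

/-- With a single continuous integrand, both the weak and the strict inequality become sign
statements about one integral. -/
theorem mul_sum_hilb_sub_eq_integral {ι : Type*} (t : Finset ι) (s : ι → HolomorphicSection n L)
    (u : HolomorphicSection n L) (M : ℝ) :
    M * ∑ i ∈ t, (hilb h (s i) (s i)).re - (hilb h u u).re =
      ∫ p, (M * ∑ i ∈ t, h.normSq p (s i p) - h.normSq p (u p)) ∂h.volume := by
  have hi (w : HolomorphicSection n L) : Integrable (fun p => h.normSq p (w p)) h.volume :=
    integrable_of_continuous h (h.continuous_normSq w)
  rw [integral_sub ((integrable_finsetSum _ fun i _ => hi (s i)).const_mul M) (hi u),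
    integral_const_mul, integral_finsetSum _ fun i _ => hi (s i)]
  simp only [re_hilb_self]

theorem hilb_le_of_normSq_le {ι : Type*} (t : Finset ι) (s : ι → HolomorphicSection n L)
    (u : HolomorphicSection n L) (M : ℝ)
    (hM : ∀ p, h.normSq p (u p) ≤ M * ∑ i ∈ t, h.normSq p (s i p)) :
    (hilb h u u).re ≤ M * ∑ i ∈ t, (hilb h (s i) (s i)).re := by
  rw [← sub_nonneg, mul_sum_hilb_sub_eq_integral]
  exact integral_nonneg fun p => sub_nonneg.2 (hM p)

theorem hilb_lt_of_normSq_le {ι : Type*} (t : Finset ι) (s : ι → HolomorphicSection n L)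
    (u : HolomorphicSection n L) (M : ℝ)
    (hM : ∀ p, h.normSq p (u p) ≤ M * ∑ i ∈ t, h.normSq p (s i p))
    (hlt : ∃ p, h.normSq p (u p) < M * ∑ i ∈ t, h.normSq p (s i p)) :
    (hilb h u u).re < M * ∑ i ∈ t, (hilb h (s i) (s i)).re := by
  obtain ⟨p, hp⟩ := hlt
  have hc : Continuous fun p => M * ∑ i ∈ t, h.normSq p (s i p) - h.normSq p (u p) :=
    (continuous_const.mul (continuous_finsetSum _ fun i _ => h.continuous_normSq (s i))).sub
      (h.continuous_normSq u)
  rw [← sub_pos, mul_sum_hilb_sub_eq_integral]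
  exact integral_pos_of_integrable_nonneg_nonzero hc (integrable_of_continuous h hc)
    (fun q => sub_nonneg.2 (hM q)) (sub_pos.2 hp).ne'

theorem hilb_last_lt [IsManifold 𝓘(ℂ, Fin n → ℂ) ω X] [ConnectedSpace X] {m : ℕ}
    {s : Fin (m + 1) → HolomorphicSection n L} (hli : LinearIndependent ℂ s)
    (hs : ∀ p, ∃ i ∈ (Finset.univ : Finset (Fin m)), s i.castSucc p ≠ 0) {M : ℝ}
    (hM : IsGreatest (range fun p : X =>
      h.normSq p (s (Fin.last m) p) / ∑ i : Fin m, h.normSq p (s i.castSucc p)) M) :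
    (hilb h (s (Fin.last m)) (s (Fin.last m))).re <
      M * ∑ i : Fin m, (hilb h (s i.castSucc) (s i.castSucc)).re := by
  have hpos (p : X) := h.sum_normSq_pos (s := fun i : Fin m => s i.castSucc) (hs p)
  have hle (p : X) : h.normSq p (s (Fin.last m) p) ≤
      M * ∑ i : Fin m, h.normSq p (s i.castSucc p) :=
    (div_le_iff₀ (hpos p)).1 (hM.2 (mem_range_self p))
  refine hilb_lt_of_normSq_le h Finset.univ (fun i : Fin m => s i.castSucc) _ M hle ?_
  obtain ⟨p₁, hp₁⟩ : ∃ p, s (Fin.last m) p ≠ 0 := by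
    by_contra! h0
    exact hli.ne_zero (Fin.last m) (ContMDiffSection.ext h0)
  have hMpos : 0 < M := (div_pos (h.normSq_pos_iff.2 hp₁) (hpos p₁)).trans_le
    (hM.2 (mem_range_self p₁))
  obtain ⟨p, hp⟩ : ∃ p, s (Fin.last m) p = 0 := by
    by_contra! hne
    -- Generation at any point supplies an index below the last one, so there is a second basis
    -- element to compare with.
    obtain ⟨i, -, -⟩ := hs p₁
    obtain ⟨c, hc⟩ := h.exists_eq_smul_of_forall_ne_zero (s i.castSucc) _ hne
    refine hli.notMem_span_image (s := {Fin.last m}) (x := i.castSucc)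
      (fun hi => (Fin.castSucc_lt_last i).ne hi) ?_
    rw [image_singleton, Submodule.mem_span_singleton]
    exact ⟨c, hc.symm⟩
  refine ⟨p, ?_⟩
  rw [hp, HermitianMetric.normSq, (h.isInner p).zero_left, Complex.zero_re]
  exact mul_pos hMpos (hpos p)

theorem not_surjOn_hilb [Nonempty X] (h : PositiveMetric n L)
    {V : Submodule ℂ (HolomorphicSection n L)} (hV : V ≠ ⊤)
    (hgen : Generates (V : Set (HolomorphicSection n L))) :
    ¬ SurjOn (hilb (n := n) (L := L)) univ
      (hermitianInnerProducts (HolomorphicSection n L)) := by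
  intro hsurj
  obtain ⟨u, -, hu⟩ := SetLike.exists_of_lt hV.lt_top
  obtain ⟨t, ht⟩ := isCompact_univ.elim_finite_subcover
    (fun s : V => {p : X | (s : HolomorphicSection n L) p ≠ 0})
    (fun s => h.isOpen_setOf_apply_ne_zero (s : HolomorphicSection n L)) fun p _ => by
      obtain ⟨s, hs, hp⟩ := hgen p
      exact mem_iUnion.2 ⟨⟨s, hs⟩, hp⟩
  have hs (p : X) : ∃ s ∈ t, (s : HolomorphicSection n L) p ≠ 0 := by
    obtain ⟨s, hst, hp⟩ := mem_iUnion₂.1 (ht (mem_univ p))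
    exact ⟨s, hst, hp⟩
  obtain ⟨M, hM⟩ := h.exists_isGreatest t (fun s : V => (s : HolomorphicSection n L)) hs u
  obtain ⟨f, hfu, hfV⟩ := Submodule.exists_le_ker_of_notMem hu
  have hfu' : 0 < Complex.normSq (f u) := Complex.normSq_pos.2 hfu
  set S := ∑ s ∈ t, (hilb h (s : HolomorphicSection n L) s).re
  -- Chosen so that $c|f(u)|^2=|MS|+1$ exceeds the bound $MS$; `S` itself does not change under the
  -- perturbation, because `f` vanishes on `V`.
  set c : ℝ := (|M * S| + 1) / Complex.normSq (f u)
  obtain ⟨g, -, hg⟩ := hsurj ((isHermitianInnerProduct_hilb h).add_mul_conj f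
    (show 0 ≤ c by positivity))
  have hle := hilb_le_of_normSq_le g t (fun s : V => (s : HolomorphicSection n L)) u M fun p =>
    (div_le_iff₀ (g.sum_normSq_pos (hs p))).1 ((hM g.toHermitianMetric).2 (mem_range_self p))
  have hgu : (hilb g u u).re = (hilb h u u).re + (|M * S| + 1) := by
    simp only [hg]
    rw [Complex.mul_conj, Complex.add_re, ← Complex.ofReal_mul, Complex.ofReal_re,
      div_mul_cancel₀ _ hfu'.ne']
  have hgs (s : V) : (hilb g (s : HolomorphicSection n L) s).re =
      (hilb h (s : HolomorphicSection n L) s).re := by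
    have h0 : f s = 0 := hfV s.2
    simp only [hg, h0, zero_mul, mul_zero, add_zero]
  simp only [hgs] at hle
  rw [hgu] at hle
  have h1 := (isHermitianInnerProduct_hilb h).re_self_nonneg u
  have h2 := le_abs_self (M * S)
  linarith

end

end HilbertMap

theorem mainTheorem5 {n : ℕ} {X : Type*} [TopologicalSpace X] [ChartedSpace (Fin n → ℂ) X]
    [IsManifold 𝓘(ℂ, Fin n → ℂ) ω X] [CompactSpace X] [T2Space X] [ConnectedSpace X]
    [MeasurableSpace X] [BorelSpace X]
    {L : X → Type*} [TopologicalSpace (TotalSpace ℂ L)]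
    [∀ x, TopologicalSpace (L x)] [∀ x, AddCommGroup (L x)] [∀ x, Module ℂ (L x)]
    [FiberBundle ℂ L] [VectorBundle ℂ ℂ L] [ContMDiffVectorBundle ω ℂ L 𝓘(ℂ, Fin n → ℂ)]
    (hL : Nonempty (HilbertMap.PositiveMetric n L)) :
    -- `Hilb` takes values in the space of hermitian inner products on `H⁰(X, L)`
    MapsTo (HilbertMap.hilb (n := n) (L := L)) univ
      (HilbertMap.hermitianInnerProducts (HilbertMap.HolomorphicSection n L)) ∧
    -- the basis is `s 0, …, s m`, and all of its members but the last one generate `L`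
    (∀ (m : ℕ) (s : Module.Basis (Fin (m + 1)) ℂ (HilbertMap.HolomorphicSection n L)),
      HilbertMap.Generates (range fun i : Fin m => s i.castSucc) →
      ∃ M : ℝ,
        (∀ h : HilbertMap.HermitianMetric n L,
          IsGreatest (range fun p : X =>
            h.normSq p (s (Fin.last m) p) / ∑ i : Fin m, h.normSq p (s i.castSucc p)) M) ∧
        ∀ h : HilbertMap.PositiveMetric n L,
          (HilbertMap.hilb h (s (Fin.last m)) (s (Fin.last m))).re <
            M * ∑ i : Fin m, (HilbertMap.hilb h (s i.castSucc) (s i.castSucc)).re) ∧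
    -- if a proper subspace of `H⁰(X, L)` already generates `L`, then `Hilb` is not surjective
    ((∃ V : Submodule ℂ (HilbertMap.HolomorphicSection n L),
        V ≠ ⊤ ∧ HilbertMap.Generates (V : Set (HilbertMap.HolomorphicSection n L))) →
      ¬ SurjOn (HilbertMap.hilb (n := n) (L := L)) univ
        (HilbertMap.hermitianInnerProducts (HilbertMap.HolomorphicSection n L))) := by

  obtain ⟨h⟩ := hL
  refine ⟨fun g _ => HilbertMap.isHermitianInnerProduct_hilb g, fun m s hs => ?_, ?_⟩
  · have hs' (p : X) : ∃ i ∈ (Finset.univ : Finset (Fin m)), s i.castSucc p ≠ 0 := by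
      obtain ⟨_, ⟨i, rfl⟩, hi⟩ := hs p
      exact ⟨i, Finset.mem_univ i, hi⟩
    obtain ⟨M, hM⟩ := h.exists_isGreatest Finset.univ (fun i : Fin m => s i.castSucc) hs'
      (s (Fin.last m))
    exact ⟨M, hM, fun g => HilbertMap.hilb_last_lt g s.linearIndependent hs'
      (hM g.toHermitianMetric)⟩
  · rintro ⟨V, hV, hgen⟩
    exact HilbertMap.not_surjOn_hilb h hV hgen
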